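/- A multiplayer multioutcome bounded energy parity game is played by a finite set $A$ of players on a finite directed graph $(V,\to)$ in which every vertex has an outgoing edge; there is a starting vertex, and each vertex is controlled by exactly one player, who chooses the next vertex whenever the play is there. For each player $a$ there are integer energy deltas $\delta_a(v)$ and priorities $\pi_a(v)\in\mathbb N$ for all $v\in V$, integers $E^a_{\min}\le e^a\le E^a_{\max}$ (energy minimum, initial energy, energy maximum), and a strict weak order on outcomes. Along a run $\rho=\rho_0\rho_1\dots$ the energy levels of $a$ are $\ell_0=\min(E^a_{\max},e^a+\delta_a(\rho_0))$ and $\ell_{i+1}=\min(E^a_{\max},\ell_i+\delta_a(\rho_{i+1}))$, so that energy in excess of the maximum is lost. The outcome of $\rho$ for $a$ is the pair consisting of the lowest level $\min_i\ell_i$, replaced by $\bot$ if some $\ell_i<E^a_{\min}$, and of the least priority $\pi_a$ visited infinitely often; player $a$ compares runs by comparing their outcomes in her strict weak order. (The win/lose condition "the energy never drops below $E^a_{\min}$ and the least priority seen infinitely often is odd" is a special case.) A strategy of player $a$ uses $m$ bits of memory if it is induced by a map $\sigma:V\times\{0,1\}^m\to V\times\{0,1\}^m$ with initial memory $0^m$: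 upon arrival at $v$ with memory content $M$, the pair $\sigma(v,M)$ consists of the chosen next vertex and the new memory content. It is a finite-memory strategy if it uses $m$ bits of memory for some $m\in\mathbb N$. Corollary. Every multiplayer multioutcome bounded energy parity game has a Nash equilibrium in finite-memory strategies. Moreover, let $n=|V|$ and let $W,E\ge 1$ be integers with $|\delta_a(v)|\le W$ and $E^a_{\max}-E^a_{\min}\le E$ for all $a\in A$, $v\in V$ (for instance, the largest absolute value of an energy delta and the largest difference between energy maximum and energy minimum, if these are positive). Then there is a Nash equilibrium in which every player's strategy uses $m$ bits of memory, for some $m\in\mathbb N$ with $$m\le 1+|A|\,n\,E^{|A|}\log_2(2nW)+(|A|^2+|A|)\log_2(nE).$$ -/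

import Mathlib

/-- The playing field of a game on a graph: a directed graph in which every vertex has an outgoing
edge, a starting vertex, and the player who controls each vertex. -/
structure Arena (V A : Type*) where
  Edge : V → V → Prop
  exists_edge : ∀ v, ∃ w, Edge v w
  start : V
  owner : V → A

namespace Arena

variable {V A : Type*}

/-- `h` followed by `v` is a finite path of the graph that begins in the starting vertex. -/
def IsHistory (G : Arena V A) (h : List V) (v : V) : Prop :=
  (h ++ [v]).head? = some G.start ∧ (h ++ [v]).IsChain G.Edge

/-- A strategy of player `a`: to each history `hv` that ends in a vertex `v` of `a` it assigns a
successor of `v`. (The value of `move` at other arguments is irrelevant.) -/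
structure Strategy (G : Arena V A) (a : A) where
  move : List V → V → V
  legal : ∀ h v, G.IsHistory h v → G.owner v = a → G.Edge v (move h v)

/-- A strategy profile: one strategy for each player. -/
abbrev Profile (G : Arena V A) := ∀ a : A, G.Strategy a

/-- The play after `n` moves, as the list of the earlier vertices and the current vertex. -/
def play (G : Arena V A) (s : G.Profile) : ℕ → List V × V
  | 0 => ([], G.start)
  | n + 1 =>
    let p := play G s n
    (p.1 ++ [p.2], (s (G.owner p.2)).move p.1 p.2)

/-- The run induced by a strategy profile. -/
def run (G : Arena V A) (s : G.Profile) (n : ℕ) : V := (G.play s n).2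

/-- A strategic implementation for player `a` with `m` bits of memory: upon arrival at a vertex,
with given memory content, it chooses the next vertex and the new memory content. -/
structure Implementation (G : Arena V A) (a : A) (m : ℕ) where
  step : V × (Fin m → Bool) → V × (Fin m → Bool)
  legal : ∀ v M, G.owner v = a → G.Edge v (step (v, M)).1

/-- The memory content after reading a finite sequence of vertices, starting from `0 … 0`. -/
def Implementation.memory {G : Arena V A} {a : A} {m : ℕ} (σ : G.Implementation a m)
    (h : List V) : Fin m → Bool :=
  h.foldl (fun M v => (σ.step (v, M)).2) (fun _ => false)

/-- The strategy `s` of player `a` is induced by a strategic implementation with `m` bits. -/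
def Strategy.UsesBits {G : Arena V A} {a : A} (s : G.Strategy a) (m : ℕ) : Prop :=
  ∃ σ : G.Implementation a m, ∀ h v, G.IsHistory h v → G.owner v = a →
    s.move h v = (σ.step (v, σ.memory h)).1

/-- Finite-memory strategies. -/
def Strategy.IsFiniteMemory {G : Arena V A} {a : A} (s : G.Strategy a) : Prop :=
  ∃ m : ℕ, s.UsesBits m

open Classical in
/-- Nash equilibria, where `pref a ρ ρ'` means that player `a` strictly prefers the run `ρ'` to the
run `ρ`: no player prefers the run that results from a change of her own strategy alone. -/
def IsNashEquilibrium (G : Arena V A) (pref : A → (ℕ → V) → (ℕ → V) → Prop)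
    (s : G.Profile) : Prop :=
  ∀ (a : A) (t : G.Strategy a), ¬ pref a (G.run s) (G.run (Function.update s a t))

end Arena

/-- Strict weak orders. -/
structure IsStrictWeak {α : Type*} (r : α → α → Prop) : Prop where
  irrefl : ∀ x, ¬ r x x
  trans : ∀ x y z, r x y → r y z → r x z
  neg_trans : ∀ x y z, ¬ r x y → ¬ r y z → ¬ r x z

/-- A multi-player multi-outcome bounded energy parity game. Each player `a` has an energy delta
and a priority at each vertex, an initial energy, an energy minimum and an energy maximum, and a
strict weak order on outcomes. An outcome consists of the lowest energy level of the run (`⊥` if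
the energy drops below the minimum) and the least priority that is visited infinitely often. -/
structure EnergyParityGame (V A : Type*) extends Arena V A where
  delta : A → V → ℤ
  priority : A → V → ℕ
  energyMin : A → ℤ
  energyMax : A → ℤ
  initEnergy : A → ℤ
  min_le_init : ∀ a, energyMin a ≤ initEnergy a
  init_le_max : ∀ a, initEnergy a ≤ energyMax a
  better : A → WithBot ℤ × ℕ → WithBot ℤ × ℕ → Prop
  better_isStrictWeak : ∀ a, IsStrictWeak (better a)

namespace EnergyParityGame

variable {V A : Type*}

/-- The energy level of player `a` after the visit of `ρ n`. Energy in excess of the maximum is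
lost. -/
def level (G : EnergyParityGame V A) (a : A) (ρ : ℕ → V) : ℕ → ℤ
  | 0 => min (G.energyMax a) (G.initEnergy a + G.delta a (ρ 0))
  | n + 1 => min (G.energyMax a) (level G a ρ n + G.delta a (ρ (n + 1)))

open Classical in
/-- The lowest energy level along `ρ`, or `⊥` if some level is below the energy minimum. -/
noncomputable def lowestLevel (G : EnergyParityGame V A) (a : A) (ρ : ℕ → V) : WithBot ℤ :=
  if ∀ n, G.energyMin a ≤ G.level a ρ n then ((⨅ n, G.level a ρ n : ℤ) : WithBot ℤ) else ⊥

/-- The least priority of player `a` that `ρ` visits infinitely often. -/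
noncomputable def leastPriority (G : EnergyParityGame V A) (a : A) (ρ : ℕ → V) : ℕ :=
  sInf {p | ∃ᶠ n in Filter.atTop, G.priority a (ρ n) = p}

noncomputable def outcome (G : EnergyParityGame V A) (a : A) (ρ : ℕ → V) : WithBot ℤ × ℕ :=
  (G.lowestLevel a ρ, G.leastPriority a ρ)

/-- `G.pref a ρ ρ'`: player `a` strictly prefers the run `ρ'` to the run `ρ`. -/
def pref (G : EnergyParityGame V A) (a : A) (ρ ρ' : ℕ → V) : Prop :=
  G.better a (G.outcome a ρ) (G.outcome a ρ')

end EnergyParityGame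

/-! For each player `a`, consider the two-player game of `a` against the coalition of all others,
played on pairs of a vertex and a status of `a` (current level and lowest level so far, or "dropped
below the minimum"). There the lowest level is a tag that can only decrease along edges, so a play's
outcome is its eventual tag together with its least recurring priority, which is a tail property.
Both sides have optimal strategies that are positional on these pairs
(`EnergyParityGame.exists_optimal`).

Positional determinacy (`exists_secures`) is an induction on regions with exits: in every region, a
vertex of least priority fixes the outcome of any play that stays there and visits it infinitely
often. Ranking outcomes by the number of states with a worse pair turns the order into a bounded
integer payoff, and the threshold games for that payoff yield values and uniform optimal strategies
(`exists_values`).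

In the equilibrium every owner plays her own optimal strategy, and after a deviation by `a`
everybody else plays the coalition's optimal strategy against `a`. The nominal and the deviating run
share their vertex and status when they split, so optimality forbids a gain. One automaton serves
all players: it stores all statuses, the expected vertex and the suspect. For `k` players and `n`
vertices it has at most `(5E²)^k (n+1) k` states. -/

namespace PositionalGame

/-! ### Positional determinacy by induction on regions with exits -/

variable {Q : Type*}

/-- Infinite paths of a graph. -/
def IsPath (Edge : Q → Q → Prop) (r : ℕ → Q) : Prop := ∀ k, Edge (r k) (r (k + 1))

/-- The sequence `r` obeys the positional strategy `σ` of player `i`. -/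
def Obeys (own : Q → Bool) (i : Bool) (σ : Q → Q) (r : ℕ → Q) : Prop :=
  ∀ k, own (r k) = i → r (k + 1) = σ (r k)

/-- Positional strategy `σ` of player `i` keeps the play inside `W` until it leaves `R`, which
can happen only through `X`; a play that stays in `R` forever is won. -/
structure Secures (Edge : Q → Q → Prop) (own : Q → Bool) (win : Bool → (ℕ → Q) → Prop)
    (i : Bool) (R X W : Set Q) (σ : Q → Q) : Prop where
  legal : ∀ v, Edge v (σ v)
  subset : ∀ v ∈ W, v ∈ X ∨ v ∈ R
  move_mem : ∀ v ∈ W, v ∈ R → own v = i → σ v ∈ W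
  edge_mem : ∀ v ∈ W, v ∈ R → own v ≠ i → ∀ w, Edge v w → w ∈ W
  wins : ∀ r, IsPath Edge r → Obeys own i σ r → (∀ k, r k ∈ W ∧ r k ∈ R) → win i r

variable {Edge : Q → Q → Prop} {own : Q → Bool} {win : Bool → (ℕ → Q) → Prop}

lemma IsPath.shift {r : ℕ → Q} (h : IsPath Edge r) (m : ℕ) : IsPath Edge fun k => r (k + m) := by
  intro k
  have := h (k + m)
  rwa [show k + m + 1 = k + 1 + m by ring] at this

lemma Obeys.shift {i : Bool} {σ : Q → Q} {r : ℕ → Q} (h : Obeys own i σ r) (m : ℕ) :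
    Obeys own i σ fun k => r (k + m) := by
  intro k hk
  have := h (k + m) hk
  rwa [show k + m + 1 = k + 1 + m by ring] at this

/-- A player who can force the play from `n` back into her region and profits from visiting `n`
infinitely often can treat `n` as an inner vertex. -/
lemma Secures.of_return [DecidableEq Q] (tail : ∀ i r m, win i (fun k => r (k + m)) → win i r)
    {R X W : Set Q} {i : Bool} {n s : Q} {σ : Q → Q} (hnR : n ∈ R)
    (hn : ∀ r, IsPath Edge r → (∀ k, r k ∈ R) → (∃ᶠ k in Filter.atTop, r k = n) → win i r)
    (hS : Secures Edge own win i (R \ {n}) (insert n X) W σ) (hs : Edge n s)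
    (hsW : own n = i → s ∈ W) (hall : own n ≠ i → ∀ w, Edge n w → w ∈ W) :
    Secures Edge own win i R X W (Function.update σ n s) := by
  refine ⟨?_, ?_, ?_, ?_, ?_⟩
  · intro v
    by_cases h : v = n
    · subst h; simpa using hs
    · simpa [h] using hS.legal v
  · intro v hv
    rcases hS.subset v hv with (rfl | h) | h
    · exact Or.inr hnR
    · exact Or.inl h
    · exact Or.inr h.1
  · intro v hv hvR ho
    by_cases h : v = n
    · subst h; simpa using hsW ho
    · simpa [h] using hS.move_mem v hv ⟨hvR, h⟩ ho
  · intro v hv hvR ho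
    by_cases h : v = n
    · subst h; exact hall ho
    · exact hS.edge_mem v hv ⟨hvR, h⟩ ho
  · intro r hr hob hmem
    by_cases hf : ∃ᶠ k in Filter.atTop, r k = n
    · exact hn r hr (fun k => (hmem k).2) hf
    · rw [Filter.not_frequently, Filter.eventually_atTop] at hf
      obtain ⟨m, hm⟩ := hf
      refine tail i r m (hS.wins _ (hr.shift m) ?_ fun k =>
        ⟨(hmem _).1, (hmem _).2, hm _ (by omega)⟩)
      intro k hk
      have := hob.shift m k hk
      simpa [hm (k + m) (by omega)] using this

/-- A region that does not contain `n` is not affected by `n` becoming an inner vertex. -/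
lemma Secures.of_notMem {R X W : Set Q} {i : Bool} {n : Q} {σ : Q → Q}
    (hS : Secures Edge own win i (R \ {n}) X W σ) (hn : n ∉ W) :
    Secures Edge own win i R X W σ := by
  have hR : ∀ v ∈ W, v ∈ R → v ∈ R \ {n} := fun v h1 h2 => ⟨h2, fun e => hn (e ▸ h1)⟩
  exact ⟨hS.legal, fun v hv => (hS.subset v hv).imp id And.left,
    fun v hv hvR => hS.move_mem v hv (hR v hv hvR),
    fun v hv hvR => hS.edge_mem v hv (hR v hv hvR),
    fun r hr hob hmem => hS.wins r hr hob fun k => ⟨(hmem k).1, hR _ (hmem k).1 (hmem k).2⟩⟩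

open Classical in
/-- If a player can force the play from `n` into the region `W`, which she secures without `n`,
then she may use `n` as an exit. -/
lemma Secures.union (tail : ∀ i r m, win i (fun k => r (k + m)) → win i r)
    {R X W U : Set Q} {i : Bool} {n s : Q} {σ ρ : Q → Q} (hnR : n ∈ R) (hnW : n ∉ W)
    (hS : Secures Edge own win i R X W σ)
    (hT : Secures Edge own win i (R \ {n}) (insert n X) U ρ) (hs : Edge n s)
    (hsW : own n = i → s ∈ W) (hall : own n ≠ i → ∀ w, Edge n w → w ∈ W) :
    Secures Edge own win i R X (W ∪ U)
      (fun v => if v ∈ W then σ v else if v = n then s else ρ v) := by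
  have next : ∀ r, IsPath Edge r →
      Obeys own i (fun v => if v ∈ W then σ v else if v = n then s else ρ v) r →
      ∀ k, r k ∈ R → r k ∈ W ∨ r k = n → r (k + 1) ∈ W := by
    intro r hr hob k hkR hk
    by_cases hkW : r k ∈ W
    · by_cases ho : own (r k) = i
      · have := hob k ho
        simp only [hkW, if_true] at this
        rw [this]
        exact hS.move_mem _ hkW hkR ho
      · exact hS.edge_mem _ hkW hkR ho _ (hr k)
    · have e := hk.resolve_left hkW
      by_cases ho : own (r k) = i
      · have := hob k ho
        rw [e] at ho
        simp only [e, hnW, if_false, if_true] at this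
        rw [this]; exact hsW ho
      · have h2 := hr k
        rw [e] at ho h2
        exact hall ho _ h2
  refine ⟨?_, ?_, ?_, ?_, ?_⟩
  · intro v
    split_ifs with h1 h2
    · exact hS.legal v
    · subst h2; exact hs
    · exact hT.legal v
  · rintro v (hv | hv)
    · exact hS.subset v hv
    · rcases hT.subset v hv with (rfl | h) | h
      · exact Or.inr hnR
      · exact Or.inl h
      · exact Or.inr h.1
  · intro v hv hvR ho
    split_ifs with h1 h2
    · exact Or.inl (hS.move_mem v h1 hvR ho)
    · subst h2; exact Or.inl (hsW ho)
    · exact Or.inr (hT.move_mem v (hv.resolve_left h1) ⟨hvR, h2⟩ ho)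
  · intro v hv hvR ho w hw
    by_cases h1 : v ∈ W
    · exact Or.inl (hS.edge_mem v h1 hvR ho w hw)
    by_cases h2 : v = n
    · subst h2; exact Or.inl (hall ho w hw)
    · exact Or.inr (hT.edge_mem v (hv.resolve_left h1) ⟨hvR, h2⟩ ho w hw)
  · intro r hr hob hmem
    -- A play that enters `W` never leaves it again; one that does not enter `W` avoids `n` as well,
    -- because the move from `n` would lead into `W`.
    by_cases hex : ∃ m, r m ∈ W
    · obtain ⟨m, hm⟩ := hex
      have hin : ∀ k, r (k + m) ∈ W := by
        intro k
        induction k with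
        | zero => simpa using hm
        | succ k ihk =>
          have := next r hr hob (k + m) (hmem _).2 (Or.inl ihk)
          rwa [show k + m + 1 = k + 1 + m by ring] at this
      refine tail _ r m (hS.wins _ (hr.shift m) ?_ fun k => ⟨hin k, (hmem _).2⟩)
      intro k hk
      have := hob.shift m k hk
      simpa [hin k] using this
    · push Not at hex
      have hne : ∀ k, r k ≠ n := fun k h =>
        hex (k + 1) (next r hr hob k (hmem k).2 (Or.inr h))
      refine hT.wins r hr ?_ fun k => ⟨(hmem k).1.resolve_left (hex k), (hmem k).2, hne k⟩
      intro k hk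
      have := hob k hk
      simpa [hex k, hne k] using this

open Classical in
/-- Positional determinacy, for winning conditions that are tail invariant and such that in every
set `R` some vertex decides the plays inside `R` that visit it infinitely often. -/
theorem exists_secures (total : ∀ v, ∃ w, Edge v w)
    (tail : ∀ i r m, win i (fun k => r (k + m)) → win i r)
    (decisive : ∀ R : Set Q, R.Nonempty → ∃ n ∈ R, ∃ i, ∀ r, IsPath Edge r → (∀ k, r k ∈ R) →
      (∃ᶠ k in Filter.atTop, r k = n) → win i r)
    (R : Finset Q) : ∀ (i : Bool) (X X' : Set Q), (∀ v, v ∈ R ∨ v ∈ X ∨ v ∈ X') →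
      (∀ v ∈ R, v ∉ X ∧ v ∉ X') → ∃ W W' σ σ', (∀ v, v ∈ W ∨ v ∈ W') ∧
        Secures Edge own win i R X W σ ∧ Secures Edge own win (!i) R X' W' σ' := by
  induction R using Finset.strongInduction with
  | H R ih =>
  intro i X X' hcov hdis
  choose succ hsucc using total
  rcases R.eq_empty_or_nonempty with rfl | hne
  · refine ⟨X, X', succ, succ, by simpa using hcov, ?_, ?_⟩ <;>
      exact ⟨hsucc, fun v hv => Or.inl hv, by simp, by simp, fun r _ _ h => by simpa using (h 0).2⟩
  obtain ⟨n, hnR, i₀, hn⟩ := decisive R hne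
  -- it suffices to treat the player who profits from infinitely many visits to `n`
  suffices key : ∀ X X' : Set Q, (∀ v, v ∈ R ∨ v ∈ X ∨ v ∈ X') →
      (∀ v ∈ R, v ∉ X ∧ v ∉ X') → ∃ W W' σ σ', (∀ v, v ∈ W ∨ v ∈ W') ∧
        Secures Edge own win i₀ R X W σ ∧ Secures Edge own win (!i₀) R X' W' σ' by
    by_cases hi : i = i₀
    · subst hi; exact key X X' hcov hdis
    · obtain ⟨W, W', σ, σ', h1, h2, h3⟩ := key X' X (fun v => by have := hcov v; tauto)
        (fun v hv => (hdis v hv).symm)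
      have e : i = !i₀ := by cases i <;> cases i₀ <;> simp_all
      subst e
      exact ⟨W', W, σ', σ, fun v => (h1 v).symm, h3, by simpa using h2⟩
  clear hcov hdis X X' i
  intro X X' hcov hdis
  have hlt : R.erase n ⊂ R := Finset.erase_ssubset hnR
  have hnX := hdis n hnR
  have hcov' : ∀ v, v ∈ R.erase n ∨ v = n ∨ v ∈ X ∨ v ∈ X' := fun v => by
    by_cases h : v = n
    · exact Or.inr (Or.inl h)
    · exact (hcov v).imp (fun h' => Finset.mem_erase.2 ⟨h, h'⟩) Or.inr
  have hdis' : ∀ v ∈ R.erase n, v ≠ n ∧ v ∉ X ∧ v ∉ X' := fun v hv =>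
    ⟨Finset.ne_of_mem_erase hv, hdis v (Finset.mem_of_mem_erase hv)⟩
  -- `n` is removed from the region and turned into an exit, here in favour of `i₀` and below in
  -- favour of the opponent.
  obtain ⟨W, W', σ, σ', hW, hS, hS'⟩ := ih _ hlt i₀ (insert n X) X'
    (fun v => by simpa only [Set.mem_insert_iff, or_assoc] using hcov' v)
    (fun v hv => by
      have := hdis' v hv
      exact ⟨fun h => h.elim this.1 this.2.1, this.2.2⟩)
  obtain ⟨U, U', ρ, ρ', hU, hT, hT'⟩ := ih _ hlt i₀ X (insert n X')
    (fun v => by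
      rcases hcov' v with h | h | h | h
      exacts [Or.inl h, Or.inr (Or.inr (Or.inl h)), Or.inr (Or.inl h),
        Or.inr (Or.inr (Or.inr h))])
    (fun v hv => by
      have := hdis' v hv
      exact ⟨this.2.1, fun h => h.elim this.1 this.2.2⟩)
  rw [Finset.coe_erase] at hS hS' hT hT'
  have hnW' : n ∉ W' := fun h => (hS'.subset n h).elim hnX.2 fun h => h.2 rfl
  have hnU : n ∉ U := fun h => (hT.subset n h).elim hnX.1 fun h => h.2 rfl
  -- Either `i₀` can force the play from `n` into `W`, so that exiting at `n` becomes returning to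
  -- it; or, since `W` and `W'` cover everything, the opponent can force it into `W'` and may use
  -- `n` as an exit.
  by_cases hforce : (own n = i₀ → ∃ w, Edge n w ∧ w ∈ W) ∧
      (own n ≠ i₀ → ∀ w, Edge n w → w ∈ W)
  · obtain ⟨s, hs, hsW⟩ : ∃ s, Edge n s ∧ (own n = i₀ → s ∈ W) := by
      by_cases h : own n = i₀
      · obtain ⟨w, h1, h2⟩ := hforce.1 h; exact ⟨w, h1, fun _ => h2⟩
      · exact ⟨succ n, hsucc n, fun h' => absurd h' h⟩
    exact ⟨W, W', _, σ', hW, hS.of_return tail hnR hn hs hsW hforce.2, hS'.of_notMem hnW'⟩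
  · obtain ⟨s, hs, hsW, hall⟩ : ∃ s, Edge n s ∧ (own n = (!i₀) → s ∈ W') ∧
        (own n ≠ (!i₀) → ∀ w, Edge n w → w ∈ W') := by
      by_cases h : own n = i₀
      · refine ⟨succ n, hsucc n, fun h' => by simp [h] at h', fun _ w hw => ?_⟩
        by_contra hcon
        exact hforce ⟨fun _ => ⟨w, hw, (hW w).resolve_right hcon⟩, fun h' => absurd h h'⟩
      · have : ∃ w, Edge n w ∧ w ∈ W' := by
          by_contra! hcon
          exact hforce ⟨fun h' => absurd h' h, fun _ w hw => (hW w).resolve_right (hcon w hw)⟩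
        obtain ⟨w, h1, h2⟩ := this
        exact ⟨w, h1, fun _ => h2, fun h' => absurd (Bool.eq_not_of_ne h) h'⟩
    exact ⟨U, W' ∪ U', ρ, _, fun v => (hU v).imp id Or.inr, hT.of_notMem hnU,
      (hS'.of_notMem hnW').union tail hnR hnW' hT' hs hsW hall⟩

/-! ### Values and optimal strategies from threshold games -/

/-- The two players' positional strategies for a common threshold cannot both be winning. -/
lemma Secures.disjoint {win win' : Bool → (ℕ → Q) → Prop} {W L : Set Q} {σ τ : Q → Q}
    (hW : Secures Edge own win true Set.univ ∅ W σ)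
    (hL : Secures Edge own win' false Set.univ ∅ L τ) {q : Q} (hqW : q ∈ W) (hqL : q ∈ L) :
    ∃ r, win true r ∧ win' false r := by
  let r : ℕ → Q := fun n => n.rec q fun _ v => if own v = true then σ v else τ v
  have hr : ∀ k, r (k + 1) = if own (r k) = true then σ (r k) else τ (r k) := fun _ => rfl
  have hpath : IsPath Edge r := fun k => by
    rw [hr]; split_ifs
    exacts [hW.legal _, hL.legal _]
  have hmem : ∀ k, r k ∈ W ∧ r k ∈ L := by
    intro k
    induction k with
    | zero => exact ⟨hqW, hqL⟩
    | succ k ih =>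
      by_cases ho : own (r k) = true
      · refine ⟨?_, hL.edge_mem _ ih.2 trivial (by simp [ho]) _ (hpath k)⟩
        rw [hr, if_pos ho]; exact hW.move_mem _ ih.1 trivial ho
      · refine ⟨hW.edge_mem _ ih.1 trivial ho _ (hpath k), ?_⟩
        rw [hr, if_neg ho]; exact hL.move_mem _ ih.2 trivial (by simpa using ho)
  refine ⟨r, hW.wins r hpath (fun k hk => ?_) fun k => ⟨(hmem k).1, trivial⟩,
    hL.wins r hpath (fun k hk => ?_) fun k => ⟨(hmem k).2, trivial⟩⟩
  · rw [hr, if_pos hk]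
  · rw [hr, if_neg (by simp [hk])]

/-- Games with tail invariant payoffs such that in every set `R` some vertex determines the payoff
of the plays inside `R` that visit it infinitely often have values, and both players have uniform
positional optimal strategies. -/
theorem exists_values [Finite Q] (total : ∀ v, ∃ w, Edge v w) (own : Q → Bool)
    (f : (ℕ → Q) → ℕ) (B : ℕ) (hB : ∀ r, f r ≤ B) (tail : ∀ r m, f (fun k => r (k + m)) = f r)
    (decisive : ∀ R : Set Q, R.Nonempty → ∃ n ∈ R, ∃ u, ∀ r, IsPath Edge r → (∀ k, r k ∈ R) →
      (∃ᶠ k in Filter.atTop, r k = n) → f r = u) :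
    ∃ (val : Q → ℕ) (σ τ : Q → Q), (∀ q, Edge q (σ q)) ∧ (∀ q, Edge q (τ q)) ∧
      (∀ r, IsPath Edge r → Obeys own true σ r → val (r 0) ≤ f r) ∧
      (∀ r, IsPath Edge r → Obeys own false τ r → f r ≤ val (r 0)) := by
  classical
  have := Fintype.ofFinite Q
  let win : ℕ → Bool → (ℕ → Q) → Prop := fun t i r => decide (t ≤ f r) = i
  have det : ∀ t, ∃ W L σ τ, (∀ v, v ∈ W ∨ v ∈ L) ∧
      Secures Edge own (win t) true Set.univ ∅ W σ ∧
      Secures Edge own (win t) false Set.univ ∅ L τ := by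
    intro t
    have := exists_secures (own := own) (win := win t) total (fun i r m h => by
      simpa only [win, tail] using h)
      (fun R hR => by
        obtain ⟨n, hn, u, hu⟩ := decisive R hR
        exact ⟨n, hn, decide (t ≤ u), fun r h1 h2 h3 => by simp only [win, hu r h1 h2 h3]⟩)
      Finset.univ true ∅ ∅ (fun v => Or.inl (Finset.mem_univ v)) (fun v _ => by simp)
    simpa using this
  choose W L σ τ hcov hW hL using det
  have hdisj : ∀ t t' q, q ∈ W t → q ∈ L t' → t < t' := by
    intro t t' q h1 h2
    obtain ⟨r, h3, h4⟩ := (hW t).disjoint (hL t') h1 h2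
    simp only [win, decide_eq_true_eq, decide_eq_false_iff_not] at h3 h4
    omega
  -- The default value 0 is harmless: the threshold 0 is met by every play.
  let val : Q → ℕ := fun q => Nat.findGreatest (fun t => q ∈ W t) B
  have hvalB : ∀ q, val q ≤ B := fun q => Nat.findGreatest_le B
  have hvalW : ∀ q, val q ≠ 0 → q ∈ W (val q) := fun q h =>
    Nat.findGreatest_of_ne_zero (P := fun t => q ∈ W t) rfl h
  have hle : ∀ q t, t ≤ B → q ∈ W t → t ≤ val q := fun q t h1 h2 =>
    Nat.le_findGreatest h1 h2
  have hvalL : ∀ q, val q < B → q ∈ L (val q + 1) := fun q h =>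
    (hcov _ q).resolve_left fun h' => by
      have := hle q _ h h'
      omega
  have hLval : ∀ q t, q ∈ L (t + 1) → val q ≤ t := fun q t h => by
    by_contra hlt
    have := hdisj _ _ q (hvalW q (by omega)) h
    omega
  -- Each player follows the threshold strategy belonging to the current value. The value then moves
  -- only in her favour, hence is eventually constant, and from that time on a single threshold
  -- strategy is obeyed.
  refine ⟨val, fun q => σ (val q) q, fun q => τ (val q + 1) q, fun q => (hW _).legal q,
    fun q => (hL _).legal q, ?_, ?_⟩
  · intro r hr hob
    have hmono : Monotone fun k => val (r k) := by
      refine monotone_nat_of_le_succ fun k => ?_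
      rcases Nat.eq_zero_or_pos (val (r k)) with h0 | hpos
      · omega
      refine hle _ _ (hvalB _) ?_
      have hmem := hvalW (r k) hpos.ne'
      by_cases ho : own (r k) = true
      · rw [hob k ho]; exact (hW _).move_mem _ hmem trivial ho
      · exact (hW _).edge_mem _ hmem trivial ho _ (hr k)
    obtain ⟨m, hm⟩ : ∃ m, ∀ k, val (r k) ≤ val (r m) := by
      obtain ⟨m, hm⟩ := WellFounded.has_min (measure fun k => B - val (r k)).wf Set.univ
        ⟨0, trivial⟩
      refine ⟨m, fun k => ?_⟩
      have h1 : ¬ (B - val (r k) < B - val (r m)) := hm.2 k trivial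
      have := hvalB (r k)
      have := hvalB (r m)
      omega
    have hconst : ∀ k, val (r (k + m)) = val (r m) := fun k =>
      le_antisymm (hm _) (hmono (by omega : m ≤ k + m))
    refine (hmono (Nat.zero_le m)).trans ?_
    dsimp only
    rcases Nat.eq_zero_or_pos (val (r m)) with h0 | hpos
    · omega
    have := (hW (val (r m))).wins _ (hr.shift m) (fun k hk => by
      have := hob.shift m k hk
      simpa only [hconst] using this) fun k => ⟨by
        have := hvalW (r (k + m)) (by rw [hconst]; omega)
        rwa [hconst] at this, trivial⟩
    simpa only [win, tail, decide_eq_true_eq] using this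
  · intro r hr hob
    have hmono : Antitone fun k => val (r k) := by
      refine antitone_nat_of_succ_le fun k => ?_
      rcases (hvalB (r k)).eq_or_lt with h0 | hlt
      · rw [h0]; exact hvalB _
      refine hLval _ _ ?_
      have hmem := hvalL (r k) hlt
      by_cases ho : own (r k) = false
      · rw [hob k ho]; exact (hL _).move_mem _ hmem trivial ho
      · exact (hL _).edge_mem _ hmem trivial ho _ (hr k)
    obtain ⟨m, hm⟩ : ∃ m, ∀ k, val (r m) ≤ val (r k) := by
      obtain ⟨m, hm⟩ := WellFounded.has_min (measure fun k => val (r k)).wf Set.univ ⟨0, trivial⟩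
      exact ⟨m, fun k => not_lt.1 (hm.2 k trivial)⟩
    have hconst : ∀ k, val (r (k + m)) = val (r m) := fun k =>
      le_antisymm (hmono (by omega : m ≤ k + m)) (hm _)
    refine le_trans ?_ (hmono (Nat.zero_le m))
    dsimp only
    rcases (hvalB (r m)).eq_or_lt with h0 | hlt
    · rw [h0]; exact hB r
    have := (hL (val (r m) + 1)).wins _ (hr.shift m) (fun k hk => by
      have := hob.shift m k hk
      simpa only [hconst] using this) fun k => ⟨by
        have := hvalL (r (k + m)) (by rw [hconst]; omega)
        rwa [hconst] at this, trivial⟩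
    simp only [win, tail, decide_eq_false_iff_not] at this
    omega

/-! ### Outcomes made of an eventual tag and a least recurring priority -/

variable {O : Type*}

/-- The eventual tag of a sequence, together with the least priority that occurs infinitely
often. -/
noncomputable def limitOutcome [Nonempty O] (tag : Q → O) (prio : Q → ℕ) (r : ℕ → Q) : O × ℕ :=
  (Classical.epsilon fun l => ∀ᶠ k in Filter.atTop, tag (r k) = l,
    sInf {p | ∃ᶠ k in Filter.atTop, prio (r k) = p})

lemma eventually_shift {p : ℕ → Prop} (m : ℕ) :
    (∀ᶠ k in Filter.atTop, p (k + m)) ↔ ∀ᶠ k in Filter.atTop, p k := by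
  conv_rhs => rw [← Filter.map_add_atTop_eq_nat m]
  rfl

lemma frequently_shift {p : ℕ → Prop} (m : ℕ) :
    (∃ᶠ k in Filter.atTop, p (k + m)) ↔ ∃ᶠ k in Filter.atTop, p k :=
  not_congr (eventually_shift (p := fun k => ¬ p k) m)

section

variable [Nonempty O] (tag : Q → O) (prio : Q → ℕ)

/-- The defining predicates themselves are unchanged by a shift, so the invariance holds even where
`epsilon` returns an arbitrary value. -/
lemma limitOutcome_shift (r : ℕ → Q) (m : ℕ) :
    limitOutcome tag prio (fun k => r (k + m)) = limitOutcome tag prio r := by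
  have h1 : ∀ l, (∀ᶠ k in Filter.atTop, tag (r (k + m)) = l) = ∀ᶠ k in Filter.atTop, tag (r k) = l :=
    fun l => propext (eventually_shift (p := fun k => tag (r k) = l) m)
  have h2 : ∀ p, (∃ᶠ k in Filter.atTop, prio (r (k + m)) = p) =
      ∃ᶠ k in Filter.atTop, prio (r k) = p :=
    fun p => propext (frequently_shift (p := fun k => prio (r k) = p) m)
  unfold limitOutcome
  simp only [h1, h2]

lemma limitOutcome_eq {r : ℕ → Q} {l : O} (h : ∀ᶠ k in Filter.atTop, tag (r k) = l) :
    limitOutcome tag prio r = (l, sInf {p | ∃ᶠ k in Filter.atTop, prio (r k) = p}) := by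
  have hex : ∃ l, ∀ᶠ k in Filter.atTop, tag (r k) = l := ⟨l, h⟩
  unfold limitOutcome
  obtain ⟨k, h1, h2⟩ := (h.and (Classical.epsilon_spec hex)).exists
  rw [← h1, ← h2]

end

/-- Tags decrease along the path, so between two visits of `n` they are squeezed to `tag n`. -/
lemma eventually_tag_eq [PartialOrder O] {tag : Q → O}
    (htag : ∀ q q', Edge q q' → tag q' ≤ tag q) {r : ℕ → Q} (hr : IsPath Edge r) {n : Q}
    (hn : ∃ᶠ k in Filter.atTop, r k = n) : ∀ᶠ k in Filter.atTop, tag (r k) = tag n := by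
  have hanti : Antitone fun k => tag (r k) := antitone_nat_of_succ_le fun k => htag _ _ (hr k)
  obtain ⟨m, rfl⟩ := hn.exists
  rw [Filter.eventually_atTop]
  refine ⟨m, fun k hk => le_antisymm (hanti hk) ?_⟩
  obtain ⟨k', hk', e⟩ := Filter.frequently_atTop.1 hn k
  rw [← e]
  exact hanti hk'

lemma exists_frequently_eq [Finite Q] (r : ℕ → Q) : ∃ n, ∃ᶠ k in Filter.atTop, r k = n := by
  by_contra! h
  obtain ⟨k, hk⟩ := (Filter.eventually_all.2 h).exists
  exact hk _ rfl

/-- Two players with opposed interests have uniform positional strategies that are optimal with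
respect to the outcome of a play: its eventual tag and its least recurring priority. -/
theorem exists_optimal [Finite Q] [PartialOrder O] [Nonempty O] {tag : Q → O}
    (htag : ∀ q q', Edge q q' → tag q' ≤ tag q) (prio : Q → ℕ)
    (total : ∀ v, ∃ w, Edge v w) (own : Q → Bool) {better : O × ℕ → O × ℕ → Prop}
    (hbetter : IsStrictWeak better) :
    ∃ σ τ : Q → Q, (∀ q, Edge q (σ q)) ∧ (∀ q, Edge q (τ q)) ∧
      ∀ r r', IsPath Edge r → IsPath Edge r' → r 0 = r' 0 → Obeys own true σ r →
        Obeys own false τ r' → ¬ better (limitOutcome tag prio r) (limitOutcome tag prio r') := by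
  -- The payoff of an outcome is the number of states whose own pair is worse.
  let rank : O × ℕ → ℕ := fun o => {q | better (tag q, prio q) o}.ncard
  obtain ⟨val, σ, τ, hσ, hτ, h1, h2⟩ := exists_values total own
    (fun r => rank (limitOutcome tag prio r)) (Nat.card Q)
    (fun r => (Set.ncard_le_ncard (Set.subset_univ _)).trans_eq (Set.ncard_univ _))
    (fun r m => by simp only [limitOutcome_shift])
    (fun R hR => by
      -- A vertex of least priority in `R` is decisive.
      obtain ⟨n, hn, hmin⟩ := WellFounded.has_min (measure prio).wf R hR
      have hmin' : ∀ q ∈ R, prio n ≤ prio q := fun q hq => not_lt.1 (hmin q hq)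
      refine ⟨n, hn, rank (tag n, prio n), fun r hr hrR hf => ?_⟩
      rw [limitOutcome_eq tag prio (eventually_tag_eq htag hr hf)]
      congr 2
      refine le_antisymm (Nat.sInf_le (hf.mono fun k e => by rw [e])) ?_
      refine le_csInf ⟨_, hf.mono fun k e => by rw [e]⟩ fun p hp => ?_
      obtain ⟨k, rfl⟩ := hp.exists
      exact hmin' _ (hrR k))
  refine ⟨σ, τ, hσ, hτ, fun r r' hr hr' h0 hob hob' hlt => ?_⟩
  have hle := (h2 r' hr' hob').trans ((congrArg val h0).symm.le.trans (h1 r hr hob))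
  refine absurd hle (not_le.2 (Set.ncard_lt_ncard ?_))
  -- For strictness: the outcome of `r` is the pair of some state of `r`, and this state is counted
  -- for `r'` but not for `r`.
  obtain ⟨n, hn⟩ := exists_frequently_eq r
  have hset : {p | ∃ᶠ k in Filter.atTop, prio (r k) = p}.Nonempty :=
    ⟨prio n, hn.mono fun k e => by rw [e]⟩
  obtain ⟨k, h3, h4⟩ :=
    ((Nat.sInf_mem hset).and_eventually (eventually_tag_eq htag hr hn)).exists
  have heq : limitOutcome tag prio r = (tag (r k), prio (r k)) := by
    rw [limitOutcome_eq tag prio (eventually_tag_eq htag hr hn), h4, h3]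
  refine ⟨fun q hq => hbetter.trans _ _ _ hq hlt, fun hsub => ?_⟩
  have : better (tag (r k), prio (r k)) (limitOutcome tag prio r) := hsub (by
    simpa only [Set.mem_ofPred_eq, ← heq] using hlt)
  rw [← heq] at this
  exact hbetter.irrefl _ this

end PositionalGame

/-! ### The game of one player against the rest, on vertices with status -/

namespace EnergyParityGame

variable {V A : Type*} (G : EnergyParityGame V A) (a : A)

/-- The energy level and the lowest energy level so far of player `a`; `none` once the energy has
dropped below the minimum. -/
abbrev Status : Type :=
  Option (Set.Icc (G.energyMin a) (G.energyMax a) × Set.Icc (G.energyMin a) (G.energyMax a))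

/-- The running minimum starts at `energyMax`, which is neutral because all levels are capped there.
The initial energy itself is not a level of the run. -/
def initStatus : G.Status a :=
  some (⟨G.initEnergy a, G.min_le_init a, G.init_le_max a⟩,
    ⟨G.energyMax a, (G.min_le_init a).trans (G.init_le_max a), le_rfl⟩)

/-- The status after a visit of `v`. -/
def nextStatus : G.Status a → V → G.Status a
  | none, _ => none
  | some (l, w), v =>
    if h : G.energyMin a ≤ min (G.energyMax a) (l + G.delta a v) then
      some (⟨_, h, min_le_left _ _⟩,
        ⟨min w (min (G.energyMax a) (l + G.delta a v)), le_min w.2.1 h,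
          (min_le_left _ _).trans w.2.2⟩)
    else none

/-- The status just before the visit of `ρ n`. -/
def status (ρ : ℕ → V) : ℕ → G.Status a
  | 0 => G.initStatus a
  | n + 1 => G.nextStatus a (status ρ n) (ρ n)

def lowest : G.Status a → WithBot ℤ
  | none => ⊥
  | some (_, w) => ((w : ℤ) : WithBot ℤ)

/-- This makes the lowest level an admissible tag. -/
lemma lowest_nextStatus_le (x : G.Status a) (v : V) :
    G.lowest a (G.nextStatus a x v) ≤ G.lowest a x := by
  rcases x with _ | ⟨l, w⟩
  · exact le_rfl
  · unfold nextStatus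
    dsimp only
    split_ifs with h
    · exact WithBot.coe_le_coe.2 (min_le_left _ _)
    · exact bot_le

/-- The index is off by one because a status is taken before the visit, a level after it. -/
lemma status_succ_eq_some {ρ : ℕ → V} {n : ℕ}
    {l w : Set.Icc (G.energyMin a) (G.energyMax a)} (h : G.status a ρ (n + 1) = some (l, w)) :
    (l : ℤ) = G.level a ρ n ∧ (∀ i ≤ n, (w : ℤ) ≤ G.level a ρ i) ∧
      (∃ i ≤ n, (w : ℤ) = G.level a ρ i) ∧ ∀ i ≤ n, G.energyMin a ≤ G.level a ρ i := by
  induction n generalizing l w with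
  | zero =>
    simp only [status, initStatus, nextStatus] at h
    split_ifs at h with h0
    simp only [Option.some.injEq, Prod.mk.injEq] at h
    obtain ⟨rfl, rfl⟩ := h
    have e : min (G.energyMax a) (min (G.energyMax a) (G.initEnergy a + G.delta a (ρ 0)))
        = G.level a ρ 0 := min_eq_right (min_le_left _ _)
    refine ⟨rfl, ?_, ⟨0, le_rfl, e⟩, ?_⟩
    · intro i hi
      obtain rfl := Nat.le_zero.1 hi
      exact e.le
    · intro i hi
      obtain rfl := Nat.le_zero.1 hi
      exact h0
  | succ n ih =>
    rw [status] at h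
    rcases hx : G.status a ρ (n + 1) with _ | ⟨l', w'⟩
    · rw [hx] at h; simp [nextStatus] at h
    rw [hx] at h
    obtain ⟨h1, h2, ⟨j, hj, h3⟩, h4⟩ := ih hx
    simp only [nextStatus] at h
    split_ifs at h with h0
    simp only [Option.some.injEq, Prod.mk.injEq] at h
    obtain ⟨rfl, rfl⟩ := h
    have e : min (G.energyMax a) ((l' : ℤ) + G.delta a (ρ (n + 1))) = G.level a ρ (n + 1) := by
      rw [level, h1]
    rw [e] at h0
    simp only [e]
    refine ⟨trivial, ?_, ?_, ?_⟩
    · intro i hi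
      rcases Nat.le_succ_iff.1 hi with hi | rfl
      · exact (min_le_left _ _).trans (h2 i hi)
      · exact min_le_right _ _
    · rcases min_choice (w' : ℤ) (G.level a ρ (n + 1)) with hm | hm
      · exact ⟨j, by omega, hm.trans h3⟩
      · exact ⟨n + 1, le_rfl, hm⟩
    · intro i hi
      rcases Nat.le_succ_iff.1 hi with hi | rfl
      · exact h4 i hi
      · exact h0

lemma exists_level_lt_of_status_eq_none {ρ : ℕ → V} {n : ℕ} (h : G.status a ρ n = none) :
    ∃ i, G.level a ρ i < G.energyMin a := by
  induction n with
  | zero => simp [status, initStatus] at h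
  | succ n ih =>
    rcases hx : G.status a ρ n with _ | ⟨l, w⟩
    · exact ih hx
    rw [status, hx] at h
    simp only [nextStatus] at h
    split_ifs at h with h0
    refine ⟨n, ?_⟩
    rw [not_le] at h0
    cases n with
    | zero =>
      simp only [status, initStatus, Option.some.injEq, Prod.mk.injEq] at hx
      rwa [← hx.1] at h0
    | succ n => rwa [(G.status_succ_eq_some a hx).1] at h0

/-- An infimum of integers bounded below is attained, and the running minimum equals it from then
on; a drop below the minimum is likewise recorded for good. -/
lemma eventually_lowest_status (ρ : ℕ → V) :
    ∀ᶠ n in Filter.atTop, G.lowest a (G.status a ρ n) = G.lowestLevel a ρ := by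
  unfold lowestLevel
  split_ifs with h
  · have hbdd : BddBelow (Set.range (G.level a ρ)) := ⟨G.energyMin a, by
      rintro _ ⟨n, rfl⟩; exact h n⟩
    obtain ⟨j, hj⟩ : ∃ j, G.level a ρ j = ⨅ n, G.level a ρ n :=
      Int.csInf_mem (Set.range_nonempty _) hbdd
    rw [Filter.eventually_atTop]
    refine ⟨j + 1, fun n hn => ?_⟩
    obtain ⟨n, rfl⟩ : ∃ k, n = k + 1 := ⟨n - 1, by omega⟩
    rcases hx : G.status a ρ (n + 1) with _ | ⟨l, w⟩
    · obtain ⟨i, hi⟩ := G.exists_level_lt_of_status_eq_none a hx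
      exact absurd (h i) (not_le.2 hi)
    · obtain ⟨-, h2, ⟨i, -, h3⟩, -⟩ := G.status_succ_eq_some a hx
      refine congrArg (fun z : ℤ => (z : WithBot ℤ)) (le_antisymm ?_ ?_)
      · rw [← hj]; exact h2 j (by omega)
      · rw [h3]; exact ciInf_le hbdd i
  · push Not at h
    obtain ⟨i, hi⟩ := h
    rw [Filter.eventually_atTop]
    refine ⟨i + 1, fun n hn => ?_⟩
    obtain ⟨n, rfl⟩ : ∃ k, n = k + 1 := ⟨n - 1, by omega⟩
    rcases hx : G.status a ρ (n + 1) with _ | ⟨l, w⟩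
    · rfl
    · exact absurd ((G.status_succ_eq_some a hx).2.2.2 i (by omega)) (not_le.2 hi)

/-- The edges of the graph of vertices together with the status of player `a` before the visit. -/
def StatusEdge (q q' : V × G.Status a) : Prop :=
  G.Edge q.1 q'.1 ∧ q'.2 = G.nextStatus a q.2 q.1

open Classical in
/-- Player `a` and her opponents have optimal strategies that depend only on the vertex and on the
status of `a`. -/
theorem exists_optimal [Finite V] : ∃ σ τ : V × G.Status a → V,
    (∀ q, G.Edge q.1 (σ q)) ∧ (∀ q, G.Edge q.1 (τ q)) ∧
    ∀ (ρ ρ' : ℕ → V) (m : ℕ), (∀ k, G.Edge (ρ k) (ρ (k + 1))) → (∀ k, G.Edge (ρ' k) (ρ' (k + 1))) →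
      ρ m = ρ' m → G.status a ρ m = G.status a ρ' m →
      (∀ k ≥ m, G.owner (ρ k) = a → ρ (k + 1) = σ (ρ k, G.status a ρ k)) →
      (∀ k ≥ m, G.owner (ρ' k) ≠ a → ρ' (k + 1) = τ (ρ' k, G.status a ρ' k)) →
      ¬ G.pref a ρ ρ' := by
  obtain ⟨σ, τ, hσ, hτ, h⟩ := PositionalGame.exists_optimal (Edge := G.StatusEdge a)
    (tag := fun q => G.lowest a q.2)
    (fun q q' hq => by rw [hq.2]; exact G.lowest_nextStatus_le a _ _)
    (fun q => G.priority a q.1)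
    (fun q => by
      obtain ⟨w, hw⟩ := G.exists_edge q.1
      exact ⟨(w, _), hw, rfl⟩)
    (fun q => decide (G.owner q.1 = a)) (G.better_isStrictWeak a)
  refine ⟨fun q => (σ q).1, fun q => (τ q).1, fun q => (hσ q).1, fun q => (hτ q).1, ?_⟩
  intro ρ ρ' m hρ hρ' h0 h0' hob hob'
  -- The status remembers the lowest level of the past, so the tail from `m` still has the outcome
  -- of the whole run.
  have out : ∀ ρ : ℕ → V, PositionalGame.limitOutcome (fun q : V × G.Status a => G.lowest a q.2)
      (fun q => G.priority a q.1) (fun k => (ρ (k + m), G.status a ρ (k + m)))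
      = G.outcome a ρ := fun ρ => by
    rw [PositionalGame.limitOutcome_shift _ _ (fun k => (ρ k, G.status a ρ k)) m,
      PositionalGame.limitOutcome_eq (fun q : V × G.Status a => G.lowest a q.2) _
        (r := fun k => (ρ k, G.status a ρ k)) (G.eventually_lowest_status a ρ)]
    rfl
  have path : ∀ ρ : ℕ → V, (∀ k, G.Edge (ρ k) (ρ (k + 1))) →
      PositionalGame.IsPath (G.StatusEdge a) (fun k => (ρ (k + m), G.status a ρ (k + m))) :=
    fun ρ hρ => PositionalGame.IsPath.shift (r := fun k => (ρ k, G.status a ρ k))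
      (fun k => ⟨hρ k, rfl⟩) m
  have := h _ _ (path ρ hρ) (path ρ' hρ') (by simp only [zero_add, h0, h0'])
    (fun k hk => by
      have e := hob (k + m) (by omega) (by simpa using hk)
      refine Prod.ext ?_ ?_
      · refine Eq.trans ?_ e
        rw [show k + 1 + m = k + m + 1 by ring]
      · rw [(hσ _).2, show k + 1 + m = k + m + 1 by ring]; rfl)
    (fun k hk => by
      have e := hob' (k + m) (by omega) (by simpa using hk)
      refine Prod.ext ?_ ?_
      · refine Eq.trans ?_ e
        rw [show k + 1 + m = k + m + 1 by ring]
      · rw [(hτ _).2, show k + 1 + m = k + m + 1 by ring]; rfl)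
  rw [out, out] at this
  exact this

end EnergyParityGame

/-! ### Plays and automata -/

namespace Arena

variable {V A : Type*} (G : Arena V A)

lemma play_succ (s : G.Profile) (n : ℕ) :
    G.play s (n + 1) = ((G.play s n).1 ++ [G.run s n],
      (s (G.owner (G.run s n))).move (G.play s n).1 (G.run s n)) := rfl

lemma isHistory_play (s : G.Profile) (n : ℕ) : G.IsHistory (G.play s n).1 (G.run s n) := by
  induction n with
  | zero => exact ⟨rfl, by simp [play]⟩
  | succ n ih =>
    have hedge : G.Edge (G.run s n) (G.run s (n + 1)) := (s _).legal _ _ ih rfl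
    obtain ⟨h1, h2⟩ := ih
    rw [play_succ]
    refine ⟨?_, ?_⟩
    · rw [List.head?_append, h1]; rfl
    · rw [List.isChain_append]
      refine ⟨h2, by simp, ?_⟩
      simp only [List.getLast?_append, List.getLast?_singleton, List.head?_cons,
        Option.mem_def]
      rintro x hx y hy
      simp only [Option.some_or, Option.some.injEq] at hx hy
      subst hx hy
      exact hedge

lemma edge_run (s : G.Profile) (n : ℕ) : G.Edge (G.run s n) (G.run s (n + 1)) :=
  (s _).legal _ _ (G.isHistory_play s n) rfl

/-- The state of an automaton with transition function `next` before it reads `ρ n`. -/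
def trace {M : Type*} (next : M → V → M) (init : M) (ρ : ℕ → V) : ℕ → M
  | 0 => init
  | n + 1 => next (trace next init ρ n) (ρ n)

lemma foldl_play {M : Type*} (next : M → V → M) (init : M) (s : G.Profile) (n : ℕ) :
    (G.play s n).1.foldl next init = trace next init (G.run s) n := by
  induction n with
  | zero => rfl
  | succ n ih => rw [play_succ, List.foldl_append, ih]; rfl

/-- The strategy of all players that is induced by an automaton with output. -/
def automatonStrategy {M : Type*} (next : M → V → M) (init : M) (out : M → V → V)
    (hout : ∀ x v, G.Edge v (out x v)) (a : A) : G.Strategy a where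
  move h v := out (h.foldl next init) v
  legal _ _ _ _ := hout _ _

lemma automatonStrategy_usesBits {M : Type*} [Finite M] (next : M → V → M) (init : M)
    (out : M → V → V) (hout : ∀ x v, G.Edge v (out x v)) (a : A) {m : ℕ}
    (hm : Nat.card M ≤ 2 ^ m) : (G.automatonStrategy next init out hout a).UsesBits m := by
  classical
  have := Fintype.ofFinite M
  obtain ⟨e⟩ : Nonempty (M ↪ (Fin m → Bool)) := by
    rw [Function.Embedding.nonempty_iff_card_le]
    rw [← Nat.card_eq_fintype_card]
    simpa using hm
  -- The swap makes the initial state correspond to the memory content `0 … 0`.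
  let enc : M → Fin m → Bool := fun x => Equiv.swap (e init) (fun _ => false) (e x)
  have henc : Function.Injective enc := (Equiv.injective _).comp e.injective
  have : Nonempty M := ⟨init⟩
  let dec := Function.invFun enc
  have hdec : ∀ x, dec (enc x) = x := Function.leftInverse_invFun henc
  let σ : G.Implementation a m :=
    ⟨fun p => (out (dec p.2) p.1, enc (next (dec p.2) p.1)), fun v x _ => hout _ _⟩
  have hmem : ∀ (h : List V) (x : M),
      h.foldl (fun y v => (σ.step (v, y)).2) (enc x) = enc (h.foldl next x) := by
    intro h
    induction h with
    | nil => intro x; rfl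
    | cons v h ih =>
      intro x
      simp only [List.foldl_cons]
      rw [← ih]
      simp only [σ, hdec]
  refine ⟨σ, fun h v _ _ => ?_⟩
  have h0 : enc init = fun _ => false := Equiv.swap_apply_left _ _
  have : σ.memory h = enc (h.foldl next init) := by
    rw [← hmem, h0]; rfl
  rw [this]
  simp only [σ, hdec, automatonStrategy]

end Arena

/-! ### The equilibrium: optimal play with punishment of the first deviator -/

namespace EnergyParityGame

variable {V A : Type*} (G : EnergyParityGame V A)

/-- The statuses of all players, the vertex that is expected next (`none` after a deviation), and
the owner of the previous vertex (after a deviation: the player who deviated). -/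
abbrev Memory : Type _ := (∀ a, G.Status a) × Option V × A

section

variable (σ τ : ∀ a, V × G.Status a → V)

/-- The vertex that follows `v` if nobody deviates. -/
def nominal (x : ∀ a, G.Status a) (v : V) : V := σ (G.owner v) (v, x (G.owner v))

/-- The last component is a placeholder: the first vertex is always the expected one. -/
def initMemory : G.Memory := (fun a => G.initStatus a, some G.start, G.owner G.start)

open Classical in
-- At an unexpected vertex the expectation becomes `none`, which no vertex matches, and the owner of
-- the previous vertex stays on record as the deviator.
noncomputable def nextMemory (M : G.Memory) (v : V) : G.Memory :=
  (fun a => G.nextStatus a (M.1 a) v,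
    if M.2.1 = some v then (some (G.nominal σ M.1 v), G.owner v) else (none, M.2.2))

open Classical in
noncomputable def choice (M : G.Memory) (v : V) : V :=
  if M.2.1 = some v then G.nominal σ M.1 v else τ M.2.2 (v, M.1 M.2.2)

end

/-- A Nash equilibrium in which all players use the same automaton. -/
theorem exists_isNashEquilibrium [Finite V] : ∃ s : G.toArena.Profile,
    G.toArena.IsNashEquilibrium G.pref s ∧
      ∀ m a, Nat.card G.Memory ≤ 2 ^ m → Finite A → (s a).UsesBits m := by
  classical
  choose σ τ hσ hτ hopt using fun a => G.exists_optimal a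
  have hchoice : ∀ M v, G.Edge v (G.choice σ τ M v) := fun M v => by
    unfold choice
    split_ifs
    exacts [hσ (G.owner v) (v, M.1 (G.owner v)), hτ M.2.2 (v, M.1 M.2.2)]
  let s : G.toArena.Profile := fun a =>
    G.toArena.automatonStrategy (G.nextMemory σ) G.initMemory (G.choice σ τ) hchoice a
  refine ⟨s, ?_, fun m a hm _ => G.toArena.automatonStrategy_usesBits _ _ _ hchoice a hm⟩
  let mem : (ℕ → V) → ℕ → G.Memory := Arena.trace (G.nextMemory σ) G.initMemory
  have hmem : ∀ ρ n, mem ρ (n + 1) = G.nextMemory σ (mem ρ n) (ρ n) := fun _ _ => rfl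
  have hstatus : ∀ ρ n a, (mem ρ n).1 a = G.status a ρ n := by
    intro ρ n a
    induction n with
    | zero => rfl
    | succ n ih =>
      rw [hmem, status, ← ih]; rfl
  -- the course of the play while nobody deviates
  have on : ∀ ρ n, (mem ρ n).2.1 = some (ρ n) →
      (mem ρ (n + 1)).2 = (some (G.nominal σ (mem ρ n).1 (ρ n)), G.owner (ρ n)) := by
    intro ρ n h
    rw [hmem, nextMemory, if_pos h]
  have off : ∀ ρ n, (mem ρ n).2.1 ≠ some (ρ n) → ∀ k, (mem ρ (n + k)).2.1 ≠ some (ρ (n + k)) ∧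
      (mem ρ (n + k)).2.2 = (mem ρ n).2.2 := by
    intro ρ n h k
    induction k with
    | zero => exact ⟨h, rfl⟩
    | succ k ih =>
      have e : (mem ρ (n + (k + 1))).2 = (none, (mem ρ (n + k)).2.2) := by
        rw [← add_assoc, hmem, nextMemory, if_neg ih.1]
      rw [e]
      exact ⟨by simp, ih.2⟩
  have hrun : ∀ n, (mem (G.run s) n).2.1 = some (G.run s n) ∧
      G.run s (n + 1) = G.nominal σ (mem (G.run s) n).1 (G.run s n) := by
    have step : ∀ n, G.run s (n + 1) = G.choice σ τ (mem (G.run s) n) (G.run s n) := by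
      intro n
      change G.choice σ τ ((G.play s n).1.foldl _ _) _ = _
      rw [Arena.foldl_play]
      rfl
    have aux : ∀ n, (mem (G.run s) n).2.1 = some (G.run s n) →
        G.run s (n + 1) = G.nominal σ (mem (G.run s) n).1 (G.run s n) := by
      intro n h
      rw [step, choice, if_pos h]
    intro n
    induction n with
    | zero => exact ⟨rfl, aux 0 rfl⟩
    | succ n ih =>
      have h : (mem (G.run s) (n + 1)).2.1 = some (G.run s (n + 1)) := by
        rw [on _ _ ih.1, ih.2]
      exact ⟨h, aux _ h⟩
  intro a t
  set s' := Function.update s a t with hs'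
  have step' : ∀ n, G.owner (G.run s' n) ≠ a →
      G.run s' (n + 1) = G.choice σ τ (mem (G.run s') n) (G.run s' n) := by
    intro n hn
    have e : s' (G.owner (G.run s' n)) = s (G.owner (G.run s' n)) := by
      rw [hs', Function.update_of_ne hn]
    change (s' (G.owner (G.run s' n))).move _ _ = _
    rw [e]
    change G.choice σ τ ((G.play s' n).1.foldl _ _) _ = _
    rw [Arena.foldl_play]
    rfl
  -- up to a deviation the two plays agree
  have agree : ∀ n, (∀ j < n, (mem (G.run s') j).2.1 = some (G.run s' j)) →
      (mem (G.run s') n).2.1 = some (G.run s n) ∧ mem (G.run s') n = mem (G.run s) n := by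
    intro n hn
    induction n with
    | zero => exact ⟨rfl, rfl⟩
    | succ n ih =>
      obtain ⟨h1, h2⟩ := ih fun j hj => hn j (by omega)
      have h3 := hn n (by omega)
      have h4 : G.run s' n = G.run s n := Option.some_injective _ (h3.symm.trans h1)
      have h5 : mem (G.run s') (n + 1) = mem (G.run s) (n + 1) := by
        rw [hmem, hmem, h2, h4]
      exact ⟨by rw [h5, (hrun _).1], h5⟩
  by_cases hdev : ∀ n, (mem (G.run s') n).2.1 = some (G.run s' n)
  · have : G.run s' = G.run s := funext fun n =>
      Option.some_injective _ ((hdev n).symm.trans (agree n fun j _ => hdev j).1)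
    rw [this]
    exact (G.better_isStrictWeak a).irrefl _
  · push Not at hdev
    -- The first unexpected vertex has index `m + 1`; the move at `m` was made by `a`, since any
    -- other owner would have moved as expected.
    have hk := Nat.find_spec hdev
    have hlt : ∀ j < Nat.find hdev, (mem (G.run s') j).2.1 = some (G.run s' j) := fun j hj =>
      not_not.1 (Nat.find_min hdev hj)
    obtain ⟨m, hm⟩ : ∃ m, Nat.find hdev = m + 1 :=
      Nat.exists_eq_succ_of_ne_zero fun h0 => by rw [h0] at hk; exact hk rfl
    rw [hm] at hk hlt
    have hon := on _ m (hlt m (by omega))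
    obtain ⟨h1, h2⟩ := agree m fun j hj => hlt j (by omega)
    have h4 : G.run s' m = G.run s m := Option.some_injective _ ((hlt m (by omega)).symm.trans h1)
    have howner : G.owner (G.run s' m) = a := by
      by_contra hne
      apply hk
      rw [hon, step' m hne, choice, if_pos (hlt m (by omega))]
    -- From `m` on, the nominal run obeys `σ a` and the deviating run obeys `τ a`; at `m` itself the
    -- latter is vacuous because `a` moves.
    refine hopt a (G.run s) (G.run s') m (Arena.edge_run _ _) (Arena.edge_run _ _) h4.symm
      (by rw [← hstatus, ← hstatus, h2]) ?_ ?_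
    · intro k _ hka
      rw [(hrun k).2, nominal, hstatus, hka]
    · intro k hkm hka
      obtain ⟨j, rfl⟩ : ∃ j, k = m + 1 + j := by
        refine ⟨k - (m + 1), ?_⟩
        have : k ≠ m := fun e => hka (e ▸ howner)
        omega
      obtain ⟨h5, h6⟩ := off _ _ hk j
      rw [hon, howner] at h6
      rw [step' _ hka, choice, if_neg h5, h6, hstatus]

/-! ### Counting memory states -/

lemma card_status_le {E : ℕ} (hE : 1 ≤ E) {a : A} (h : G.energyMax a - G.energyMin a ≤ E) :
    Nat.card (G.Status a) ≤ 5 * E ^ 2 := by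
  have h1 : Nat.card (Set.Icc (G.energyMin a) (G.energyMax a)) ≤ E + 1 := by
    rw [Nat.card_eq_fintype_card, Fintype.card_ofFinset, Int.card_Icc]
    omega
  rw [Finite.card_option, Nat.card_prod]
  nlinarith [Nat.mul_le_mul h1 h1]

lemma card_memory_le [Fintype V] [Fintype A] {E : ℕ} (hE : 1 ≤ E)
    (h : ∀ a, G.energyMax a - G.energyMin a ≤ E) :
    Nat.card G.Memory ≤ (5 * E ^ 2) ^ Fintype.card A *
      ((Fintype.card V + 1) * Fintype.card A) := by
  rw [Nat.card_prod, Nat.card_prod, Finite.card_option, Nat.card_pi, Nat.card_eq_fintype_card,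
    Nat.card_eq_fintype_card]
  refine Nat.mul_le_mul_right _ ?_
  exact Finset.prod_le_pow_card _ _ _ fun a _ => G.card_status_le hE (h a)

/-- If there is only one vertex, then there is only one run. -/
lemma exists_isNashEquilibrium_of_subsingleton [Subsingleton V] :
    ∃ s : G.toArena.Profile, G.toArena.IsNashEquilibrium G.pref s ∧ ∀ a, (s a).UsesBits 0 := by
  choose succ hsucc using G.exists_edge
  refine ⟨G.toArena.automatonStrategy (fun x _ => x) () (fun _ => succ) fun _ => hsucc, ?_,
    fun a => G.toArena.automatonStrategy_usesBits _ _ _ _ a (by simp)⟩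
  intro a t
  unfold pref
  convert (G.better_isStrictWeak a).irrefl _ using 3

end EnergyParityGame

lemma memory_bound {k n E : ℕ} (hk : 1 ≤ k) (hn : 2 ≤ n) :
    (5 * E ^ 2) ^ k * ((n + 1) * k) ≤ 16 ^ k * (n * E) ^ (2 * k) := by
  have h1 : n + 1 ≤ n ^ (2 * k) := by
    calc n + 1 ≤ n ^ 2 := by nlinarith
      _ ≤ n ^ (2 * k) := Nat.pow_le_pow_right (by omega) (by omega)
  have h2 : k ≤ 2 ^ k := Nat.lt_two_pow_self.le
  calc (5 * E ^ 2) ^ k * ((n + 1) * k)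
      ≤ (5 * E ^ 2) ^ k * (n ^ (2 * k) * 2 ^ k) := by gcongr
    _ = 10 ^ k * (n * E) ^ (2 * k) := by
        rw [mul_pow, mul_pow, ← pow_mul, show (10 : ℕ) = 5 * 2 by norm_num, mul_pow]; ring
    _ ≤ 16 ^ k * (n * E) ^ (2 * k) := by gcongr; norm_num

/-- In base 2 the first factor has exponent `4k`, absorbed by the first summand since `n E^k ≥ 2`
and `log₂(2nW) ≥ 2`; the second uses `2k ≤ k² + k`. -/
lemma pow_le_two_rpow {k n E W : ℕ} (hn : 2 ≤ n) (hE : 1 ≤ E) (hW : 1 ≤ W) (hk : 1 ≤ k) :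
    (16 : ℝ) ^ k * ((n : ℝ) * E) ^ (2 * k) ≤
      2 ^ ((k : ℝ) * n * (E : ℝ) ^ k * Real.logb 2 (2 * n * W) +
        ((k : ℝ) ^ 2 + k) * Real.logb 2 (n * E)) := by
  have hn' : (2 : ℝ) ≤ n := by exact_mod_cast hn
  have hE' : (1 : ℝ) ≤ E := by exact_mod_cast hE
  have hW' : (1 : ℝ) ≤ W := by exact_mod_cast hW
  have hk' : (1 : ℝ) ≤ k := by exact_mod_cast hk
  have hnE : (1 : ℝ) ≤ n * E := by nlinarith
  have hL : 0 ≤ Real.logb 2 (n * E) := Real.logb_nonneg (by norm_num) hnE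
  have hlog : (2 : ℝ) ≤ Real.logb 2 (2 * n * W) := by
    rw [Real.le_logb_iff_rpow_le (by norm_num) (by positivity)]
    norm_num
    nlinarith
  have h1 : (2 : ℝ) ≤ n * (E : ℝ) ^ k := by
    nlinarith [one_le_pow₀ hE' (n := k)]
  have e : (16 : ℝ) ^ k * ((n : ℝ) * E) ^ (2 * k) =
      2 ^ ((4 * k : ℕ) + Real.logb 2 (n * E) * (2 * k : ℕ) : ℝ) := by
    rw [Real.rpow_add (by norm_num), Real.rpow_natCast, Real.rpow_mul (by norm_num),
      Real.rpow_natCast, Real.rpow_logb (by norm_num) (by norm_num) (by linarith),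
      show (16 : ℝ) = 2 ^ 4 by norm_num, ← pow_mul]
  rw [e]
  refine Real.rpow_le_rpow_of_exponent_le (by norm_num) (add_le_add ?_ ?_)
  · push_cast
    calc (4 : ℝ) * k = k * (2 * 2) := by ring
      _ ≤ k * ((n * (E : ℝ) ^ k) * Real.logb 2 (2 * n * W)) := by gcongr
      _ = _ := by ring
  · push_cast
    rw [mul_comm]
    gcongr
    nlinarith

theorem mainTheorem3 {V A : Type*} [Fintype V] [Fintype A] (G : EnergyParityGame V A) :
    (∃ s : G.toArena.Profile, G.toArena.IsNashEquilibrium G.pref s ∧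
      ∀ a, (s a).IsFiniteMemory) ∧
    ∀ W E : ℕ, 1 ≤ W → 1 ≤ E →
      (∀ a v, |G.delta a v| ≤ (W : ℤ)) →
      (∀ a, G.energyMax a - G.energyMin a ≤ (E : ℤ)) →
      ∃ m : ℕ,
        (m : ℝ) ≤ 1
          + (Fintype.card A : ℝ) * (Fintype.card V : ℝ) * (E : ℝ) ^ Fintype.card A
            * Real.logb 2 (2 * (Fintype.card V : ℝ) * (W : ℝ))
          + ((Fintype.card A : ℝ) ^ 2 + (Fintype.card A : ℝ))
            * Real.logb 2 ((Fintype.card V : ℝ) * (E : ℝ)) ∧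
        ∃ s : G.toArena.Profile, G.toArena.IsNashEquilibrium G.pref s ∧
          ∀ a, (s a).UsesBits m := by
  obtain ⟨s, hs, hbits⟩ := G.exists_isNashEquilibrium
  refine ⟨⟨s, hs, fun a => ⟨Nat.card G.Memory, hbits _ a Nat.lt_two_pow_self.le inferInstance⟩⟩, ?_⟩
  intro W E hW hE _ hEmax
  have hk : 1 ≤ Fintype.card A := Fintype.card_pos_iff.2 ⟨G.owner G.start⟩
  have hW' : (1 : ℝ) ≤ W := by exact_mod_cast hW
  have hE' : (1 : ℝ) ≤ E := by exact_mod_cast hE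
  have hn' : (1 : ℝ) ≤ Fintype.card V := by
    exact_mod_cast Fintype.card_pos_iff.2 ⟨G.start⟩
  have hlog₁ : 0 ≤ Real.logb 2 (2 * (Fintype.card V : ℝ) * (W : ℝ)) :=
    Real.logb_nonneg (by norm_num) (by nlinarith)
  have hlog₂ : 0 ≤ Real.logb 2 ((Fintype.card V : ℝ) * (E : ℝ)) :=
    Real.logb_nonneg (by norm_num) (by nlinarith)
  -- The estimates need `n ≥ 2`; with one vertex no memory is needed.
  rcases le_or_gt (Fintype.card V) 1 with hn | hn
  · have := Fintype.card_le_one_iff_subsingleton.1 hn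
    refine ⟨0, ?_, G.exists_isNashEquilibrium_of_subsingleton⟩
    rw [Nat.cast_zero]
    positivity
  · have hbound := pow_le_two_rpow (k := Fintype.card A) hn hE hW hk
    rw [add_assoc]
    set b := (Fintype.card A : ℝ) * (Fintype.card V : ℝ) * (E : ℝ) ^ Fintype.card A
            * Real.logb 2 (2 * (Fintype.card V : ℝ) * (W : ℝ))
          + ((Fintype.card A : ℝ) ^ 2 + (Fintype.card A : ℝ))
            * Real.logb 2 ((Fintype.card V : ℝ) * (E : ℝ))
    have hb : 0 ≤ b := by positivity
    -- Rounding up accounts for the summand 1 of the bound.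
    refine ⟨⌈b⌉₊, ?_, s, hs, fun a => hbits _ a ?_ inferInstance⟩
    · have := Nat.ceil_lt_add_one hb
      linarith
    · have h1 := (G.card_memory_le hE hEmax).trans (memory_bound hk hn)
      have h2 : (2 : ℝ) ^ b ≤ 2 ^ ⌈b⌉₊ := by
        rw [← Real.rpow_natCast]
        exact Real.rpow_le_rpow_of_exponent_le (by norm_num) (Nat.le_ceil b)
      have h3 : (Nat.card G.Memory : ℝ) ≤ 2 ^ ⌈b⌉₊ :=
        (le_trans (by exact_mod_cast h1) hbound).trans h2
      exact_mod_cast h3
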